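/- Define integers $u(n)$ and rational numbers $v(n)$ $(n\ge 0)$ by $u(0)=v(0)=1$ and, for $n\ge 1$, $$u(n)=3^2 7^2\cdots(4n-1)^2-\sum_{m=0}^{n-1}\binom{2n+1}{2m+1}\,1^2 5^2\cdots(4(n-m)-3)^2\,u(m),$$ $$v(n)=2^{n-1}\,1^2 5^2\cdots(4n-3)^2-\frac12\sum_{m=1}^{n-1}\binom{2n}{2m}v(m)v(n-m);$$ equivalently, as formal power series, $$\sum_{n\ge0}\frac{u(n)}{(2n+1)!}t^n=\frac{{}_2F_1(\frac34,\frac34;\frac32;4t)}{{}_2F_1(\frac14,\frac14;\frac12;4t)},\qquad \sum_{n\ge0}\frac{v(n)}{2^n(2n)!}t^n=\sqrt{{}_2F_1(\tfrac14,\tfrac14;\tfrac12;4t)}.$$ Put $$s(n,k)=\frac{(2n)!}{(2k)!}\,[z^{2n}]\Bigl(\sum_{j\ge0}\frac{u(j)}{(2j+1)!}z^{2j+1}\Bigr)^{2k},$$ and define Romik's sequence $d(n)$ $(n\ge 0)$ by $$d(n)=v(n)-\sum_{k=1}^{n-1}2^{n-k}s(n,k)\,d(k).$$ **Theorem 1.2.**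 Every $d(n)$ is an integer, and for every prime $p\equiv1\pmod 4$ and every $n\ge\frac{p+1}2$, $$d\Bigl(n+\frac{p-1}2\Bigr)\equiv-2^{\frac{p-1}2}\Bigl(\prod_{i=1}^{\frac{p-1}2}(4i-1)^2\Bigr)d(n)=-2^{\frac{p-1}2}\,3^2 7^2\cdots(2p-3)^2\,d(n)\pmod p.$$ -/

import Mathlib

noncomputable section

namespace Romik

/-- `1² · 5² ⋯ (4n - 3)²`, with `n` factors. -/
def prodOne (n : ℕ) : ℤ := ∏ i ∈ Finset.Icc 1 n, (4 * (i : ℤ) - 3) ^ 2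

/-- `3² · 7² ⋯ (4n - 1)²`, with `n` factors. -/
def prodThree (n : ℕ) : ℤ := ∏ i ∈ Finset.Icc 1 n, (4 * (i : ℤ) - 1) ^ 2

/-- The integer sequence `u`, given by its recurrence; `u_rec` is the unfolded form and
`u_genFun` the description by a quotient of hypergeometric series. -/
def u (n : ℕ) : ℤ :=
  prodThree n - ∑ m ∈ (Finset.range n).attach,
    ((2 * n + 1).choose (2 * m.1 + 1) : ℤ) * prodOne (n - m.1) * u m.1
termination_by n
decreasing_by exact Finset.mem_range.mp m.2

/-- The sequence `v` (as rational numbers), given by its recurrence; `v_rec` is the unfolded form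
and `v_genFun` the description by the square root of a hypergeometric series. -/
def v (n : ℕ) : ℚ :=
  if n = 0 then 1 else
    2 ^ (n - 1) * (prodOne n : ℚ) - 1 / 2 * ∑ m ∈ (Finset.Ico 1 n).attach,
      ((2 * n).choose (2 * m.1) : ℚ) * v m.1 * v (n - m.1)
termination_by n
decreasing_by
  · exact (Finset.mem_Ico.mp m.2).2
  · have := Finset.mem_Ico.mp m.2
    omega

/-- The formal power series `∑ j, u j / (2j+1)! * z ^ (2j+1)`. -/
def uSeries : PowerSeries ℚ :=
  PowerSeries.mk fun i => if Odd i then (u (i / 2) : ℚ) / (i.factorial : ℚ) else 0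

/-- `s n k = (2n)! / (2k)! * [z ^ (2n)] (∑ j, u j / (2j+1)! * z ^ (2j+1)) ^ (2k)`. -/
def s (n k : ℕ) : ℚ :=
  ((2 * n).factorial : ℚ) / ((2 * k).factorial : ℚ) *
    PowerSeries.coeff (2 * n) (uSeries ^ (2 * k))

/-- Romik's sequence `d` (as rational numbers), given by
`d n = v n - ∑_{k=1}^{n-1} 2 ^ (n-k) * s n k * d k`; see `d_rec`. -/
def d (n : ℕ) : ℚ :=
  v n - ∑ k ∈ (Finset.Ico 1 n).attach, 2 ^ (n - k.1) * s n k.1 * d k.1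
termination_by n
decreasing_by exact (Finset.mem_Ico.mp k.2).2

theorem u_rec (n : ℕ) :
    u n = prodThree n - ∑ m ∈ Finset.range n,
      ((2 * n + 1).choose (2 * m + 1) : ℤ) * prodOne (n - m) * u m := by
  rw [u, Finset.sum_attach (Finset.range n)
    (fun m => ((2 * n + 1).choose (2 * m + 1) : ℤ) * prodOne (n - m) * u m)]

theorem v_zero : v 0 = 1 := by rw [v]; simp

theorem v_rec (n : ℕ) (hn : 1 ≤ n) :
    v n = 2 ^ (n - 1) * (prodOne n : ℚ) - 1 / 2 * ∑ m ∈ Finset.Ico 1 n,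
      ((2 * n).choose (2 * m) : ℚ) * v m * v (n - m) := by
  rw [v, if_neg (by omega), Finset.sum_attach (Finset.Ico 1 n)
    (fun m => ((2 * n).choose (2 * m) : ℚ) * v m * v (n - m))]

theorem d_rec (n : ℕ) :
    d n = v n - ∑ k ∈ Finset.Ico 1 n, 2 ^ (n - k) * s n k * d k := by
  rw [d, Finset.sum_attach (Finset.Ico 1 n) (fun k => 2 ^ (n - k) * s n k * d k)]

/-- The formal power series `₂F₁(a, b; c; 4t)` in `t`. -/
def hypSeries (a b c : ℚ) : PowerSeries ℚ :=
  PowerSeries.mk fun n => ordinaryHypergeometricCoefficient a b c n * 4 ^ n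

theorem coeff_hypSeries_one (n : ℕ) :
    PowerSeries.coeff n (hypSeries (1 / 4) (1 / 4) (1 / 2)) =
      (prodOne n : ℚ) / ((2 * n).factorial : ℚ) := by
  rw [hypSeries, PowerSeries.coeff_mk]
  induction n with
  | zero => simp [prodOne, ordinaryHypergeometricCoefficient]
  | succ n ih =>
    have h : (prodOne (n + 1) : ℚ) = prodOne n * (4 * n + 1) ^ 2 := by
      rw [prodOne, prodOne, Finset.prod_Icc_succ_top (by omega)]
      push_cast
      ring
    have h2 : ((2 * (n + 1)).factorial : ℚ) = (2 * n + 2) * (2 * n + 1) * (2 * n).factorial := by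
      rw [show 2 * (n + 1) = 2 * n + 1 + 1 by ring, Nat.factorial_succ, Nat.factorial_succ]
      push_cast
      ring
    have h3 : (1 / 2 + n : ℚ) ≠ 0 := by positivity
    have h4 : ordinaryHypergeometricCoefficient (1 / 4 : ℚ) (1 / 4) (1 / 2) (n + 1) * 4 ^ (n + 1) =
        (ordinaryHypergeometricCoefficient (1 / 4 : ℚ) (1 / 4) (1 / 2) n * 4 ^ n) *
          ((4 * n + 1) ^ 2 / ((2 * n + 2) * (2 * n + 1))) := by
      simp only [ordinaryHypergeometricCoefficient, ascPochhammer_succ_eval, Nat.factorial_succ,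
        Nat.cast_mul, mul_inv, pow_succ]
      push_cast
      field_simp
      ring
    rw [h4, ih, h, h2]
    field_simp

theorem coeff_hypSeries_three (n : ℕ) :
    PowerSeries.coeff n (hypSeries (3 / 4) (3 / 4) (3 / 2)) =
      (prodThree n : ℚ) / ((2 * n + 1).factorial : ℚ) := by
  rw [hypSeries, PowerSeries.coeff_mk]
  induction n with
  | zero => simp [prodThree, ordinaryHypergeometricCoefficient]
  | succ n ih =>
    have h : (prodThree (n + 1) : ℚ) = prodThree n * (4 * n + 3) ^ 2 := by
      rw [prodThree, prodThree, Finset.prod_Icc_succ_top (by omega)]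
      push_cast
      ring
    have h2 : ((2 * (n + 1) + 1).factorial : ℚ) =
        (2 * n + 3) * (2 * n + 2) * (2 * n + 1).factorial := by
      rw [show 2 * (n + 1) + 1 = 2 * n + 1 + 1 + 1 by ring, Nat.factorial_succ,
        Nat.factorial_succ (2 * n + 1)]
      push_cast
      ring
    have h3 : (3 / 2 + n : ℚ) ≠ 0 := by positivity
    have h4 : ordinaryHypergeometricCoefficient (3 / 4 : ℚ) (3 / 4) (3 / 2) (n + 1) * 4 ^ (n + 1) =
        (ordinaryHypergeometricCoefficient (3 / 4 : ℚ) (3 / 4) (3 / 2) n * 4 ^ n) *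
          ((4 * n + 3) ^ 2 / ((2 * n + 3) * (2 * n + 2))) := by
      simp only [ordinaryHypergeometricCoefficient, ascPochhammer_succ_eval, Nat.factorial_succ,
        Nat.cast_mul, mul_inv, pow_succ]
      push_cast
      field_simp
      ring
    rw [h4, ih, h, h2]
    field_simp

/-- `∑ n, u n / (2n+1)! * t ^ n = ₂F₁(3/4, 3/4; 3/2; 4t) / ₂F₁(1/4, 1/4; 1/2; 4t)`. -/
theorem u_genFun :
    (PowerSeries.mk fun n => (u n : ℚ) / ((2 * n + 1).factorial : ℚ)) =
      hypSeries (3 / 4) (3 / 4) (3 / 2) * (hypSeries (1 / 4) (1 / 4) (1 / 2))⁻¹ := by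
  have h0 : PowerSeries.constantCoeff (hypSeries (1 / 4) (1 / 4) (1 / 2)) ≠ 0 := by
    rw [← PowerSeries.coeff_zero_eq_constantCoeff_apply, coeff_hypSeries_one]
    simp [prodOne]
  rw [PowerSeries.eq_mul_inv_iff_mul_eq h0]
  ext n
  rw [PowerSeries.coeff_mul, Finset.Nat.sum_antidiagonal_eq_sum_range_succ_mk,
    coeff_hypSeries_three, Finset.sum_range_succ]
  simp only [coeff_hypSeries_one, PowerSeries.coeff_mk]
  have hu : (u n : ℚ) = prodThree n - ∑ m ∈ Finset.range n,
      ((2 * n + 1).choose (2 * m + 1) : ℚ) * prodOne (n - m) * u m := by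
    exact_mod_cast u_rec n
  have hs : ∑ m ∈ Finset.range n, ((2 * n + 1).choose (2 * m + 1) : ℚ) * prodOne (n - m) * u m =
      ((2 * n + 1).factorial : ℚ) * ∑ m ∈ Finset.range n,
        (u m : ℚ) / ((2 * m + 1).factorial : ℚ) *
          ((prodOne (n - m) : ℚ) / ((2 * (n - m)).factorial : ℚ)) := by
    rw [Finset.mul_sum]
    refine Finset.sum_congr rfl fun m hm => ?_
    have hm := Finset.mem_range.mp hm
    rw [Nat.cast_choose ℚ (by omega : 2 * m + 1 ≤ 2 * n + 1),
      show 2 * n + 1 - (2 * m + 1) = 2 * (n - m) by omega]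
    ring
  have hf : ((2 * n + 1).factorial : ℚ) ≠ 0 := by positivity
  rw [hu, hs]
  simp [prodOne]
  field_simp
  ring

/-- `(∑ n, v n / (2 ^ n * (2n)!) * t ^ n) ^ 2 = ₂F₁(1/4, 1/4; 1/2; 4t)`; together with `v_zero`
this says that the series on the left is the square root with constant term `1`. -/
theorem v_genFun :
    (PowerSeries.mk fun n => v n / (2 ^ n * ((2 * n).factorial : ℚ))) ^ 2 =
      hypSeries (1 / 4) (1 / 4) (1 / 2) := by
  ext n
  rw [pow_two, PowerSeries.coeff_mul, Finset.Nat.sum_antidiagonal_eq_sum_range_succ_mk,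
    coeff_hypSeries_one]
  simp only [PowerSeries.coeff_mk]
  rcases Nat.eq_zero_or_pos n with rfl | hn
  · simp [v_zero, prodOne]
  rw [Finset.sum_range_succ, Finset.range_eq_Ico, Finset.sum_eq_sum_Ico_succ_bot hn]
  have hs : ∑ m ∈ Finset.Ico 1 n, ((2 * n).choose (2 * m) : ℚ) * v m * v (n - m) =
      (2 ^ n * ((2 * n).factorial : ℚ)) * ∑ m ∈ Finset.Ico 1 n,
        v m / (2 ^ m * ((2 * m).factorial : ℚ)) *
          (v (n - m) / (2 ^ (n - m) * ((2 * (n - m)).factorial : ℚ))) := by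
    rw [Finset.mul_sum]
    refine Finset.sum_congr rfl fun m hm => ?_
    have hm := Finset.mem_Ico.mp hm
    rw [Nat.cast_choose ℚ (by omega : 2 * m ≤ 2 * n),
      show 2 * n - 2 * m = 2 * (n - m) by omega,
      show (2 : ℚ) ^ n = 2 ^ m * 2 ^ (n - m) by rw [← pow_add]; congr 1; omega]
    field_simp
  have hv := v_rec n hn
  rw [hs] at hv
  have h2 : (2 : ℚ) ^ n = 2 * 2 ^ (n - 1) := by rw [← pow_succ']; congr 1; omega
  have hf : ((2 * n).factorial : ℚ) ≠ 0 := by positivity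
  simp only [zero_add, Nat.sub_zero, Nat.sub_self, v_zero, Nat.mul_zero, Nat.factorial_zero,
    pow_zero, Nat.cast_one, mul_one, div_one, one_mul]
  generalize (∑ m ∈ Finset.Ico 1 n, v m / (2 ^ m * ((2 * m).factorial : ℚ)) *
          (v (n - m) / (2 ^ (n - m) * ((2 * (n - m)).factorial : ℚ)))) = S at *
  rw [hv, h2]
  field_simp
  ring

end Romik

end

/-! Let A, B, U, V be the series `aGen`, `bGen`, `uGen`, `vGen`, so that V² = A and U = B/A. The
recursion for d(n) says V = ∑ d(k) U^(2k)/(2k)!. With δ = g·d/dX and g = 1/U', that is, δ = d/dU,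
this reads d(n) = (δ^(2n) V)(0). Since A and B solve the same second order equation, their Wronskian
is explicit and g = (1 - 8X²)A². All these series lie in the ring of exponential generating
functions with integer coefficients, which δ preserves; hence d(n) is an integer.

Modulo p, E = δ^p - hδ is again a derivation. It satisfies E f ≡ f'·E X for polynomials of degree
less than p, but not for X^p/p!. If p ≡ 1 mod 4, then p is one of the factors 4i - 3, so A reduces
to such a polynomial and the chain rule holds for A and g. It follows that E X ≡ k·g with k
constant, and comparing E U with E of the truncation of U gives k ≡ 0 when h is minus the p-th
coefficient of U (`frob_X_mem_prime`). Then E A ≡ 0, so E V ≡ 0 because V² = A (`frob_sqrt_mem`).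
Applying δ^(2n-1) to δ^p V ≡ hδV and evaluating at 0 gives the congruence, with h ≡
-2^((p-1)/2)·3²·7²⋯(2p-3)² by `u_modEq_prodThree`. -/

noncomputable section

namespace Romik

open PowerSeries Finset
open scoped Nat

/-! ### Exponential generating functions with integer coefficients, modulo `m` -/

/-- The power series `∑ aₙ Xⁿ / n!` all of whose `aₙ` are integers divisible by `m`. -/
def egfIdeal (m : ℤ) : AddSubgroup ℚ⟦X⟧ where
  carrier := {f | ∀ n, ∃ a : ℤ, (n ! : ℚ) * coeff n f = m * a}
  zero_mem' n := ⟨0, by simp⟩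
  add_mem' {f g} hf hg n := by
    obtain ⟨a, ha⟩ := hf n
    obtain ⟨b, hb⟩ := hg n
    exact ⟨a + b, by rw [map_add, mul_add, ha, hb]; push_cast; ring⟩
  neg_mem' {f} hf n := by
    obtain ⟨a, ha⟩ := hf n
    exact ⟨-a, by rw [map_neg, mul_neg, ha]; push_cast; ring⟩

/-- The exponential generating function of a sequence. -/
def egf (a : ℕ → ℚ) : ℚ⟦X⟧ := PowerSeries.mk fun n => a n / n !

theorem factorial_mul_coeff_egf (a : ℕ → ℚ) (n : ℕ) : (n ! : ℚ) * coeff n (egf a) = a n := by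
  have : (n ! : ℚ) ≠ 0 := by positivity
  rw [egf, coeff_mk]
  field_simp

theorem egf_mem (a : ℕ → ℤ) {m : ℤ} (h : ∀ n, m ∣ a n) :
    egf (fun n => (a n : ℚ)) ∈ egfIdeal m := by
  intro n
  obtain ⟨b, hb⟩ := h n
  exact ⟨b, by rw [factorial_mul_coeff_egf, hb]; push_cast; ring⟩

theorem factorial_mul_coeff_mul (f g : ℚ⟦X⟧) (n : ℕ) :
    (n ! : ℚ) * coeff n (f * g) = ∑ ij ∈ antidiagonal n,
      (n.choose ij.1 : ℚ) * ((ij.1 ! : ℚ) * coeff ij.1 f) * ((ij.2 ! : ℚ) * coeff ij.2 g) := by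
  rw [coeff_mul, mul_sum]
  refine sum_congr rfl fun ij h => ?_
  have h := mem_antidiagonal.mp h
  rw [← h, ← Nat.add_choose_mul_factorial_mul_factorial ij.1 ij.2, Nat.choose_symm_add]
  push_cast
  ring

theorem mul_mem_egfIdeal {m : ℤ} {f g : ℚ⟦X⟧} (hf : f ∈ egfIdeal 1) (hg : g ∈ egfIdeal m) :
    f * g ∈ egfIdeal m := by
  intro n
  choose a ha using hf
  choose b hb using hg
  refine ⟨∑ ij ∈ antidiagonal n, (n.choose ij.1 : ℤ) * a ij.1 * b ij.2, ?_⟩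
  rw [factorial_mul_coeff_mul]
  push_cast
  rw [mul_sum]
  refine sum_congr rfl fun ij _ => ?_
  rw [ha, hb]
  push_cast
  ring

theorem one_mem_egfIdeal : (1 : ℚ⟦X⟧) ∈ egfIdeal 1 := by
  intro n
  refine ⟨if n = 0 then 1 else 0, ?_⟩
  rw [coeff_one]
  split_ifs with h <;> simp [h]

theorem X_mem_egfIdeal : (X : ℚ⟦X⟧) ∈ egfIdeal 1 := by
  intro n
  refine ⟨if n = 1 then 1 else 0, ?_⟩
  rw [coeff_X]
  split_ifs with h <;> simp [h]

theorem pow_mem_egfIdeal {f : ℚ⟦X⟧} (hf : f ∈ egfIdeal 1) (k : ℕ) : f ^ k ∈ egfIdeal 1 := by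
  induction k with
  | zero => simpa using one_mem_egfIdeal
  | succ k ih => rw [pow_succ]; exact mul_mem_egfIdeal ih hf

theorem intCast_mul_mem {m : ℤ} {f : ℚ⟦X⟧} (c : ℤ) (hf : f ∈ egfIdeal m) :
    (c : ℚ⟦X⟧) * f ∈ egfIdeal m := by
  rw [← zsmul_eq_mul]
  exact AddSubgroup.zsmul_mem _ hf c

theorem coeff_intCast_mul (c : ℤ) (f : ℚ⟦X⟧) (n : ℕ) :
    coeff n ((c : ℚ⟦X⟧) * f) = c * coeff n f := by
  rw [← zsmul_eq_mul, map_zsmul, zsmul_eq_mul]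

theorem mem_egfIdeal_of_dvd {m c : ℤ} {f : ℚ⟦X⟧} (h : m ∣ c) (hf : f ∈ egfIdeal 1) :
    (c : ℚ⟦X⟧) * f ∈ egfIdeal m := by
  obtain ⟨b, rfl⟩ := h
  intro n
  obtain ⟨a, ha⟩ := hf n
  refine ⟨b * a, ?_⟩
  rw [coeff_intCast_mul, mul_left_comm, ha]
  push_cast
  ring

theorem mem_egfIdeal_of_isCoprime {m c : ℤ} {f : ℚ⟦X⟧} (h : IsCoprime m c)
    (hf : f ∈ egfIdeal 1) (hcf : (c : ℚ⟦X⟧) * f ∈ egfIdeal m) : f ∈ egfIdeal m := by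
  intro n
  obtain ⟨a, ha⟩ := hf n
  obtain ⟨b, hb⟩ := hcf n
  rw [coeff_intCast_mul, mul_left_comm, ha] at hb
  have hb' : c * a = m * b := by
    have : (c : ℚ) * a = m * b := by rw [← hb]; push_cast; ring
    exact_mod_cast this
  obtain ⟨e, rfl⟩ := h.dvd_of_dvd_mul_left ⟨b, hb'⟩
  exact ⟨e, by rw [ha]; push_cast; ring⟩

theorem derivative_mem_egfIdeal {m : ℤ} {f : ℚ⟦X⟧} (hf : f ∈ egfIdeal m) :
    derivative ℚ f ∈ egfIdeal m := by
  intro n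
  obtain ⟨a, ha⟩ := hf (n + 1)
  refine ⟨a, ?_⟩
  rw [← ha, coeff_derivative, Nat.factorial_succ]
  push_cast
  ring

/-- Differentiation merely shifts the sequence `aₙ`, so modulo `m` only constants have derivative
zero; the Frobenius kernel of ordinary power series does not arise. -/
theorem sub_constantCoeff_mem {m : ℤ} {f : ℚ⟦X⟧} (hf : derivative ℚ f ∈ egfIdeal m) :
    f - C (constantCoeff f) ∈ egfIdeal m := by
  rintro (_ | n)
  · exact ⟨0, by simp⟩
  · obtain ⟨a, ha⟩ := hf n
    refine ⟨a, ?_⟩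
    rw [← ha, coeff_derivative, Nat.factorial_succ, map_sub, coeff_C, if_neg (by omega)]
    push_cast
    ring

theorem constantCoeff_of_mem {m : ℤ} {f : ℚ⟦X⟧} (hf : f ∈ egfIdeal m) :
    ∃ a : ℤ, constantCoeff f = m * a := by
  simpa using hf 0

theorem intCast_eq_C (c : ℤ) : (c : ℚ⟦X⟧) = C (c : ℚ) := by simp

/-! ### Iterates of the derivation `g · d/dX` -/

theorem iterate_leibniz (D : Derivation ℚ ℚ⟦X⟧ ℚ⟦X⟧) (f g : ℚ⟦X⟧) (n : ℕ) :
    D^[n] (f * g) = ∑ ij ∈ antidiagonal n, (n.choose ij.1 : ℚ⟦X⟧) * (D^[ij.1] f * D^[ij.2] g) := by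
  induction n with
  | zero => simp
  | succ n ih =>
    rw [sum_antidiagonal_choose_succ_mul (fun i j => D^[i] f * D^[j] g) n,
      Function.iterate_succ_apply', ih, map_sum, ← sum_add_distrib]
    refine sum_congr rfl fun ij h => ?_
    rw [← nsmul_eq_mul, map_nsmul, Derivation.leibniz, nsmul_eq_mul,
      Function.iterate_succ_apply', Function.iterate_succ_apply', smul_eq_mul, smul_eq_mul,
      ← Nat.choose_symm_of_eq_add (mem_antidiagonal.mp h).symm]
    ring

/-- The derivation `g · d/dX`. -/
def der (g : ℚ⟦X⟧) : Derivation ℚ ℚ⟦X⟧ ℚ⟦X⟧ := g • derivative ℚ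

theorem der_apply (g f : ℚ⟦X⟧) : der g f = g * derivative ℚ f := rfl

theorem der_intCast_mul (g : ℚ⟦X⟧) (c : ℤ) (f : ℚ⟦X⟧) : der g (c * f) = c * der g f := by
  rw [← zsmul_eq_mul, map_zsmul, zsmul_eq_mul]

theorem derivative_intCast_mul (c : ℤ) (f : ℚ⟦X⟧) :
    derivative ℚ (c * f) = c * derivative ℚ f := by
  rw [← zsmul_eq_mul, map_zsmul, zsmul_eq_mul]

theorem iterate_der_sub (g f f' : ℚ⟦X⟧) (n : ℕ) :
    (der g)^[n] (f - f') = (der g)^[n] f - (der g)^[n] f' :=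
  iterate_map_sub (der g) n f f'

theorem iterate_der_add (g f f' : ℚ⟦X⟧) (n : ℕ) :
    (der g)^[n] (f + f') = (der g)^[n] f + (der g)^[n] f' :=
  iterate_map_add (der g) n f f'

theorem iterate_der_intCast_mul (g : ℚ⟦X⟧) (c : ℤ) (f : ℚ⟦X⟧) (n : ℕ) :
    (der g)^[n] (c * f) = c * (der g)^[n] f := by
  rw [← zsmul_eq_mul, iterate_map_zsmul (der g) n, zsmul_eq_mul]

theorem iterate_der_mem {m : ℤ} {g f : ℚ⟦X⟧} (hg : g ∈ egfIdeal 1) (hf : f ∈ egfIdeal m) (n : ℕ) :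
    (der g)^[n] f ∈ egfIdeal m := by
  induction n with
  | zero => exact hf
  | succ n ih =>
    rw [Function.iterate_succ_apply']
    exact mul_mem_egfIdeal hg (derivative_mem_egfIdeal ih)

/-- If `g` has constant term `1`, then `(g · d/dX)ⁿ` followed by evaluation at `0` agrees with
`(d/dX)ⁿ` followed by evaluation at `0` on the multiples of `Xⁿ`. -/
theorem constantCoeff_iterate_der {g f : ℚ⟦X⟧} (hg : constantCoeff g = 1) {n : ℕ}
    (hf : X ^ n ∣ f) : constantCoeff ((der g)^[n] f) = n ! * coeff n f := by
  induction n generalizing f with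
  | zero => simp
  | succ n ih =>
    have h1 : X ^ n ∣ derivative ℚ f := by
      rw [X_pow_dvd_iff] at hf ⊢
      intro m hm
      rw [coeff_derivative, hf _ (by omega), zero_mul]
    obtain ⟨q, hq⟩ := h1
    rw [Function.iterate_succ_apply, ih (der_apply g f ▸ Dvd.dvd.mul_left ⟨q, hq⟩ g)]
    -- As `X ^ n` divides `f'`, only the constant term 1 of `g` contributes in degree `n`.
    have h2 : coeff n (der g f) = coeff (n + 1) f * (n + 1) := by
      have key (r : ℚ⟦X⟧) : coeff n (X ^ n * r) = constantCoeff r := by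
        simpa using coeff_X_pow_mul r n 0
      rw [← coeff_derivative, der_apply, hq, mul_left_comm, key, key, map_mul, hg, one_mul]
    rw [h2, Nat.factorial_succ]
    push_cast
    ring

/-! ### The operator `δᵖ - h δ` modulo `p` -/

/-- `δᵖ - h δ` for the derivation `δ = g · d/dX`. -/
def frob (p : ℕ) (h : ℤ) (g f : ℚ⟦X⟧) : ℚ⟦X⟧ := (der g)^[p] f - h * der g f

variable {p : ℕ} {h : ℤ} {g : ℚ⟦X⟧}

theorem frob_add (f f' : ℚ⟦X⟧) : frob p h g (f + f') = frob p h g f + frob p h g f' := by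
  simp only [frob, iterate_der_add, map_add]
  ring

theorem frob_sub (f f' : ℚ⟦X⟧) : frob p h g (f - f') = frob p h g f - frob p h g f' := by
  simp only [frob, iterate_der_sub, map_sub]
  ring

theorem frob_intCast_mul (c : ℤ) (f : ℚ⟦X⟧) : frob p h g (c * f) = c * frob p h g f := by
  simp only [frob, iterate_der_intCast_mul, der_intCast_mul]
  ring

theorem frob_mem {m : ℤ} {f : ℚ⟦X⟧} (hg : g ∈ egfIdeal 1) (hf : f ∈ egfIdeal m) :
    frob p h g f ∈ egfIdeal m :=
  sub_mem (iterate_der_mem hg hf p) (intCast_mul_mem h (iterate_der_mem hg hf 1))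

theorem der_frob (f : ℚ⟦X⟧) : der g (frob p h g f) = frob p h g (der g f) := by
  simp only [frob, map_sub, der_intCast_mul, ← Function.iterate_succ_apply',
    Function.iterate_succ_apply]

theorem frob_one (hp : p ≠ 0) : frob p h g 1 = 0 := by
  obtain ⟨q, rfl⟩ := Nat.exists_eq_succ_of_ne_zero hp
  have h1 : der g 1 = 0 := Derivation.map_one_eq_zero _
  rw [frob, Function.iterate_succ_apply, h1, iterate_map_zero (der g), mul_zero, sub_zero]

/-- In characteristic `p`, the map `δᵖ - h δ` is a derivation. -/
theorem frob_mul (hp : p.Prime) (hg : g ∈ egfIdeal 1) {f f' : ℚ⟦X⟧} (hf : f ∈ egfIdeal 1)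
    (hf' : f' ∈ egfIdeal 1) :
    frob p h g (f * f') - (frob p h g f * f' + f * frob p h g f') ∈ egfIdeal p := by
  -- The defect consists of the inner Leibniz terms of `δᵖ`, whose binomials are divisible by `p`;
  -- `h δ` is a derivation and contributes nothing.
  have hs : frob p h g (f * f') - (frob p h g f * f' + f * frob p h g f') =
      ∑ i ∈ Ico 1 p, (((p.choose i : ℕ) : ℤ) : ℚ⟦X⟧) * ((der g)^[i] f * (der g)^[p - i] f') := by
    have h1 : (der g)^[p] (f * f') = f * (der g)^[p] f' + (der g)^[p] f * f' +
        ∑ i ∈ Ico 1 p, (p.choose i : ℚ⟦X⟧) * ((der g)^[i] f * (der g)^[p - i] f') := by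
      rw [iterate_leibniz, Nat.sum_antidiagonal_eq_sum_range_succ_mk, sum_range_succ,
        range_eq_Ico, sum_eq_sum_Ico_succ_bot hp.pos]
      simp
      ring
    simp only [frob, h1, Derivation.leibniz, smul_eq_mul]
    push_cast
    ring
  rw [hs]
  refine sum_mem fun i hi => mem_egfIdeal_of_dvd ?_
    (mul_mem_egfIdeal (iterate_der_mem hg hf _) (iterate_der_mem hg hf' _))
  have hi := mem_Ico.mp hi
  exact_mod_cast hp.dvd_choose_self (by omega) hi.2

/-! ### The chain rule modulo `p` and its consequences -/

/-- The series `f` on which `δᵖ - h δ` acts modulo `p` by the chain rule. -/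
def Chain (p : ℕ) (h : ℤ) (g f : ℚ⟦X⟧) : Prop :=
  f ∈ egfIdeal 1 ∧ frob p h g f - derivative ℚ f * frob p h g X ∈ egfIdeal p

theorem frob_X_mem (hg : g ∈ egfIdeal 1) : frob p h g X ∈ egfIdeal 1 :=
  frob_mem hg X_mem_egfIdeal

theorem Chain.add {f f' : ℚ⟦X⟧} (hf : Chain p h g f) (hf' : Chain p h g f') :
    Chain p h g (f + f') := by
  refine ⟨add_mem hf.1 hf'.1, ?_⟩
  convert add_mem hf.2 hf'.2 using 1
  rw [frob_add, map_add]
  ring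

theorem Chain.intCast_mul {f : ℚ⟦X⟧} (c : ℤ) (hf : Chain p h g f) : Chain p h g (c * f) := by
  refine ⟨intCast_mul_mem c hf.1, ?_⟩
  convert intCast_mul_mem c hf.2 using 1
  rw [frob_intCast_mul, derivative_intCast_mul]
  ring

theorem Chain.sub {f f' : ℚ⟦X⟧} (hf : Chain p h g f) (hf' : Chain p h g f') :
    Chain p h g (f - f') := by
  refine ⟨sub_mem hf.1 hf'.1, ?_⟩
  convert sub_mem hf.2 hf'.2 using 1
  rw [frob_sub, map_sub]
  ring

theorem mem_egfIdeal_one {m : ℤ} {f : ℚ⟦X⟧} (hf : f ∈ egfIdeal m) : f ∈ egfIdeal 1 := by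
  intro n
  obtain ⟨a, ha⟩ := hf n
  exact ⟨m * a, by rw [ha]; push_cast; ring⟩

theorem mul_mem_egfIdeal' {m : ℤ} {f f' : ℚ⟦X⟧} (hf : f ∈ egfIdeal m) (hf' : f' ∈ egfIdeal 1) :
    f * f' ∈ egfIdeal m := mul_comm f f' ▸ mul_mem_egfIdeal hf' hf

theorem Chain.of_mem (hg : g ∈ egfIdeal 1) {f : ℚ⟦X⟧} (hf : f ∈ egfIdeal p) : Chain p h g f :=
  ⟨mem_egfIdeal_one hf, sub_mem (frob_mem hg hf)
    (mul_mem_egfIdeal' (derivative_mem_egfIdeal hf) (frob_X_mem hg))⟩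

theorem Chain.mul (hp : p.Prime) (hg : g ∈ egfIdeal 1) {f f' : ℚ⟦X⟧} (hf : Chain p h g f)
    (hf' : Chain p h g f') : Chain p h g (f * f') := by
  refine ⟨mul_mem_egfIdeal hf.1 hf'.1, ?_⟩
  convert add_mem (frob_mul (h := h) hp hg hf.1 hf'.1)
    (add_mem (mul_mem_egfIdeal hf.1 hf'.2) (mul_mem_egfIdeal hf'.1 hf.2)) using 1
  rw [Derivation.leibniz, smul_eq_mul, smul_eq_mul]
  ring

theorem chain_one (hp : p ≠ 0) : Chain p h g 1 := by
  refine ⟨one_mem_egfIdeal, ?_⟩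
  rw [frob_one hp, Derivation.map_one_eq_zero]
  simp [zero_mem]

theorem chain_X : Chain p h g X := by
  refine ⟨X_mem_egfIdeal, ?_⟩
  rw [derivative_X]
  simp [zero_mem]

theorem Chain.pow (hp : p.Prime) (hg : g ∈ egfIdeal 1) {f : ℚ⟦X⟧} (hf : Chain p h g f) (n : ℕ) :
    Chain p h g (f ^ n) := by
  induction n with
  | zero => simpa using chain_one hp.ne_zero
  | succ n ih => rw [pow_succ]; exact ih.mul hp hg hf

theorem Chain.of_isCoprime {c : ℤ} (hc : IsCoprime (p : ℤ) c) (hg : g ∈ egfIdeal 1) {f : ℚ⟦X⟧}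
    (hf : f ∈ egfIdeal 1) (hcf : Chain p h g (c * f)) : Chain p h g f := by
  refine ⟨hf, mem_egfIdeal_of_isCoprime hc (sub_mem (frob_mem hg hf)
    (mul_mem_egfIdeal' (derivative_mem_egfIdeal hf) (frob_X_mem hg))) ?_⟩
  convert hcf.2 using 1
  rw [frob_intCast_mul, derivative_intCast_mul]
  ring

/-- The divided power `Xⁿ / n!`. -/
def divPow (n : ℕ) : ℚ⟦X⟧ := monomial n (1 / n ! : ℚ)

theorem divPow_mem (n : ℕ) : divPow n ∈ egfIdeal 1 := by
  intro k
  refine ⟨if k = n then 1 else 0, ?_⟩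
  have : (n ! : ℚ) ≠ 0 := by positivity
  rw [divPow, coeff_monomial]
  split_ifs with hk
  · subst hk; field_simp; simp
  · simp

theorem factorial_mul_divPow (n : ℕ) : ((n ! : ℤ) : ℚ⟦X⟧) * divPow n = X ^ n := by
  have : (n ! : ℚ) ≠ 0 := by positivity
  rw [X_pow_eq, divPow]
  ext k
  rw [coeff_intCast_mul, coeff_monomial, coeff_monomial]
  split_ifs
  · push_cast; field_simp
  · simp

/-- The chain rule for powers of `X` follows from the product rule, and `n!` is invertible modulo
`p` for `n < p`. The bound is sharp: if `g(0) = 1`, then `δᵖ - h δ` sends `Xᵖ / p!` to a series with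
constant term 1. -/
theorem chain_divPow (hp : p.Prime) (hg : g ∈ egfIdeal 1) {n : ℕ} (hn : n < p) :
    Chain p h g (divPow n) := by
  refine Chain.of_isCoprime (c := (n ! : ℤ)) ?_ hg (divPow_mem n) ?_
  · exact Nat.isCoprime_iff_coprime.mpr
      ((Nat.coprime_factorial_iff hp.one_lt.ne').mpr (by rwa [hp.minFac_eq]))
  · rw [factorial_mul_divPow]
    exact chain_X.pow hp hg n

/-- The part of degree less than `m` of the exponential generating function of `a`. -/
def egfTrunc (a : ℕ → ℤ) (m : ℕ) : ℚ⟦X⟧ := ∑ n ∈ range m, (a n : ℚ⟦X⟧) * divPow n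

theorem coeff_egfTrunc (a : ℕ → ℤ) (m n : ℕ) :
    coeff n (egfTrunc a m) = if n < m then (a n : ℚ) / n ! else 0 := by
  rw [egfTrunc, map_sum]
  simp only [coeff_intCast_mul, divPow, coeff_monomial]
  simp [div_eq_mul_inv]

theorem chain_egfTrunc (hp : p.Prime) (hg : g ∈ egfIdeal 1) (a : ℕ → ℤ) :
    ∀ m ≤ p, Chain p h g (egfTrunc a m) := by
  intro m
  induction m with
  | zero =>
    intro _
    simpa [egfTrunc] using Chain.of_mem (h := h) hg (zero_mem (egfIdeal p))
  | succ m ih =>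
    intro hm
    rw [egfTrunc, sum_range_succ]
    exact (ih (by omega)).add ((chain_divPow hp hg (by omega)).intCast_mul _)

theorem chain_egf (hp : p.Prime) (hg : g ∈ egfIdeal 1) (a : ℕ → ℤ)
    (ha : ∀ n, p ≤ n → (p : ℤ) ∣ a n) : Chain p h g (egf fun n => a n) := by
  rw [← sub_add_cancel (egf fun n => (a n : ℚ)) (egfTrunc a p)]
  refine Chain.add (Chain.of_mem hg fun n => ?_) (chain_egfTrunc hp hg a p le_rfl)
  rw [map_sub, coeff_egfTrunc, mul_sub, factorial_mul_coeff_egf]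
  split_ifs with hn
  · refine ⟨0, ?_⟩
    have : (n ! : ℚ) ≠ 0 := by positivity
    field_simp
    simp
  · obtain ⟨b, hb⟩ := ha n (by omega)
    exact ⟨b, by rw [hb]; push_cast; ring⟩

/-- Write E = `δᵖ - h δ` and `E X = g w`. As E commutes with `δ` and `δ X = g`, the chain rule for
`g` gives `g (g w)' ≡ g' g w`, hence `w' ≡ 0` and `w` is a constant `k`. The choice `h = -a p` then
forces `k ≡ 0`, because the degree `p` term of `U`, where the chain rule breaks down, accounts for
all of `E U` at 0. -/
theorem frob_X_mem_prime (hp : p.Prime) (hg : Chain p h g g) (hg0 : constantCoeff g = 1)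
    (a : ℕ → ℤ) (ha : g * derivative ℚ (egf fun n => a n) = 1) (hap : a p = -h) :
    frob p h g X ∈ egfIdeal p := by
  set U : ℚ⟦X⟧ := egf fun n => a n with hU
  have hUm : U ∈ egfIdeal 1 := egf_mem a fun n => one_dvd _
  have hU' : derivative ℚ U ∈ egfIdeal 1 := derivative_mem_egfIdeal hUm
  set w : ℚ⟦X⟧ := derivative ℚ U * frob p h g X with hw
  have hwm : w ∈ egfIdeal 1 := mul_mem_egfIdeal hU' (frob_X_mem hg.1)
  have hEw : frob p h g X = g * w := by rw [hw, ← mul_assoc, ha, one_mul]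
  clear_value w
  -- `w = (δᵖ X - h δ X) / g` is constant modulo `p`
  have hdw : derivative ℚ w ∈ egfIdeal p := by
    have h1 : der g (frob p h g X) = frob p h g g := by
      rw [der_frob, der_apply g X, derivative_X, mul_one]
    have h2 := hg.2
    rw [← h1, der_apply] at h2
    have h3 := mul_mem_egfIdeal hU' (mul_mem_egfIdeal hU' h2)
    convert h3 using 1
    have h4 : derivative ℚ (frob p h g X) = g * derivative ℚ w + w * derivative ℚ g := by
      rw [hEw, Derivation.leibniz, smul_eq_mul, smul_eq_mul]
    rw [h4, hEw]
    linear_combination (-derivative ℚ w * (g * derivative ℚ U + 1)) * ha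
  obtain ⟨k, hk⟩ := constantCoeff_of_mem hwm
  rw [Int.cast_one, one_mul] at hk
  have hwk := sub_constantCoeff_mem hdw
  rw [hk, ← intCast_eq_C] at hwk
  have hEk : frob p h g X - k * g ∈ egfIdeal p := by
    convert mul_mem_egfIdeal hg.1 hwk using 1
    rw [hEw]; ring
  -- evaluating `δᵖ U - h δ U` at `0` shows that this constant vanishes
  have hEU : frob p h g U = ((-h : ℤ) : ℚ⟦X⟧) := by
    have hd : der g U = 1 := by rw [der_apply, ha]
    obtain ⟨q, hq⟩ : ∃ q, p = q + 2 := ⟨p - 2, by have := hp.two_le; omega⟩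
    have h1 : der g 1 = 0 := Derivation.map_one_eq_zero _
    have : (der g)^[p] U = 0 := by
      rw [hq, Function.iterate_succ_apply, Function.iterate_succ_apply, hd, h1,
        iterate_map_zero (der g)]
    rw [frob, this, hd]
    push_cast
    ring
  have hT := (chain_egfTrunc (h := h) hp hg.1 a p le_rfl).2
  set T := egfTrunc a p with hTdef
  have hdvd : X ^ p ∣ U - T := by
    rw [X_pow_dvd_iff]
    intro m hm
    rw [map_sub, hTdef, coeff_egfTrunc, if_pos hm, hU, egf, coeff_mk, sub_self]
  have hUT : constantCoeff (frob p h g (U - T)) = -h := by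
    -- Since `U - T` starts in degree `p > 1`, only `δᵖ` contributes at 0, and it returns the
    -- coefficient `a p`.
    have h1 : constantCoeff (der g (U - T)) = 0 := by
      have h2 := (X_pow_dvd_iff.mp hdvd) 1 hp.one_lt
      rw [der_apply, map_mul, ← coeff_zero_eq_constantCoeff_apply (derivative ℚ _),
        coeff_derivative, zero_add, h2, zero_mul, mul_zero]
    rw [frob, map_sub, map_mul, h1, mul_zero, sub_zero, constantCoeff_iterate_der hg0 hdvd,
      map_sub, mul_sub, hTdef, coeff_egfTrunc, if_neg (lt_irrefl p), mul_zero, sub_zero, hU,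
      factorial_mul_coeff_egf, hap]
    push_cast
    ring
  have hT0 : constantCoeff (derivative ℚ T) = 1 := by
    have h2 := congrArg constantCoeff ha
    have h3 := (X_pow_dvd_iff.mp hdvd) 1 hp.one_lt
    rw [map_mul, hg0, one_mul, map_one, ← coeff_zero_eq_constantCoeff_apply,
      coeff_derivative] at h2
    rw [map_sub, sub_eq_zero] at h3
    rw [← coeff_zero_eq_constantCoeff_apply, coeff_derivative, zero_add, ← h3]
    simpa using h2
  -- Both `E U` and `E (U - T)` equal `-h` at 0, so `E T` vanishes there; by the chain rule it is
  -- also congruent to `T'(0) · k = k`.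
  rw [frob_sub, hEU, map_sub, map_intCast, Int.cast_neg, sub_eq_self] at hUT
  obtain ⟨b, hb⟩ := constantCoeff_of_mem hT
  obtain ⟨c, hc⟩ := constantCoeff_of_mem hEk
  rw [map_sub, map_mul, hUT, hT0, one_mul] at hb
  rw [map_sub, map_mul, hg0, mul_one, map_intCast] at hc
  have hkp : (p : ℤ) ∣ k := by
    refine ⟨-b - c, ?_⟩
    have : (k : ℚ) = p * (-b - c) := by push_cast at hb hc; linarith
    exact_mod_cast this
  have := add_mem hEk (mem_egfIdeal_of_dvd hkp hg.1)
  rwa [sub_add_cancel] at this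

/-- If `V ^ 2` obeys the chain rule and `V` is invertible then `δᵖ V ≡ h δ V`. -/
theorem frob_sqrt_mem (hp : p.Prime) (hp2 : p ≠ 2) (hg : g ∈ egfIdeal 1)
    (hX : frob p h g X ∈ egfIdeal p) {V W : ℚ⟦X⟧} (hV : V ∈ egfIdeal 1) (hW : W ∈ egfIdeal 1)
    (hVW : V * W = 1) (hV2 : Chain p h g (V ^ 2)) : frob p h g V ∈ egfIdeal p := by
  have h1 : frob p h g (V ^ 2) ∈ egfIdeal p := by
    have := add_mem hV2.2 (mul_mem_egfIdeal (derivative_mem_egfIdeal hV2.1) hX)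
    rwa [sub_add_cancel] at this
  have h2 := frob_mul (h := h) hp hg hV hV
  rw [← pow_two] at h2
  refine mem_egfIdeal_of_isCoprime (c := 2) ?_ (frob_mem hg hV) ?_
  · have := (Nat.coprime_primes hp Nat.prime_two).mpr hp2
    exact_mod_cast Nat.isCoprime_iff_coprime.mpr this
  -- Modulo `p`, `0 ≡ E (V²) ≡ 2 V · E V`; multiplying by the inverse `W` of `V` leaves `2 · E V`.
  · convert mul_mem_egfIdeal hW (sub_mem h1 h2) using 1
    push_cast
    linear_combination (-2 * frob p h g V) * hVW

/-! ### The generating functions A, B, U, V -/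

/-- The substitution `t ↦ 2 X²`. -/
def twoSq : ℚ⟦X⟧ →+* ℚ⟦X⟧ :=
  ((expand 2 two_ne_zero : ℚ⟦X⟧ →ₐ[ℚ] ℚ⟦X⟧) : ℚ⟦X⟧ →+* ℚ⟦X⟧).comp (rescale 2)

theorem coeff_twoSq (f : ℚ⟦X⟧) (n : ℕ) :
    coeff n (twoSq f) = if Even n then 2 ^ (n / 2) * coeff (n / 2) f else 0 := by
  have h1 : twoSq f = expand 2 two_ne_zero (rescale 2 f) := rfl
  rw [h1]
  split_ifs with h
  · obtain ⟨m, rfl⟩ := h.two_dvd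
    rw [coeff_expand_mul, coeff_rescale, Nat.mul_div_cancel_left _ two_pos]
  · exact coeff_expand_of_not_dvd _ _ _ (by rwa [← even_iff_two_dvd])

/-- The integers `a` with `₂F₁(1/4, 1/4; 1/2; 8 X²) = ∑ aₙ Xⁿ / n!`. -/
def aSeq (n : ℕ) : ℤ := if Even n then 2 ^ (n / 2) * prodOne (n / 2) else 0

/-- The integers `b` with `X ₂F₁(3/4, 3/4; 3/2; 8 X²) = ∑ bₙ Xⁿ / n!`. -/
def bSeq (n : ℕ) : ℤ := if Even n then 0 else 2 ^ (n / 2) * prodThree (n / 2)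

/-- The coefficients of `∑ 2ʲ u(j) X ^ (2j+1) / (2j+1)!`. -/
def uSeq (n : ℕ) : ℤ := if Even n then 0 else 2 ^ (n / 2) * u (n / 2)

/-- The coefficients of `∑ v(j) X ^ (2j) / (2j)!`. -/
def vSeq (n : ℕ) : ℚ := if Even n then v (n / 2) else 0

def aGen : ℚ⟦X⟧ := egf fun n => aSeq n

def bGen : ℚ⟦X⟧ := egf fun n => bSeq n

def uGen : ℚ⟦X⟧ := egf fun n => uSeq n

def vGen : ℚ⟦X⟧ := egf vSeq

/-- The series `∑ u(n) tⁿ / (2n+1)!`. -/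
def uRed : ℚ⟦X⟧ := PowerSeries.mk fun n => (u n : ℚ) / ((2 * n + 1)! : ℚ)

theorem aGen_eq : aGen = twoSq (hypSeries (1 / 4) (1 / 4) (1 / 2)) := by
  ext n
  rw [coeff_twoSq, aGen, egf, coeff_mk, coeff_hypSeries_one, aSeq]
  split_ifs with h
  · rw [Nat.two_mul_div_two_of_even h]
    push_cast
    ring
  · simp

theorem coeff_X_mul_twoSq (f : ℚ⟦X⟧) (n : ℕ) :
    coeff n (X * twoSq f) = if Even n then 0 else 2 ^ (n / 2) * coeff (n / 2) f := by
  rcases n with _ | n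
  · simp
  · rw [coeff_succ_X_mul, coeff_twoSq]
    by_cases h : Even n
    · rw [if_pos h, if_neg (by rwa [Nat.even_add_one, not_not]), Nat.succ_div_of_not_dvd]
      rwa [← even_iff_two_dvd, Nat.even_add_one, not_not]
    · rw [if_neg h, if_pos (by rwa [Nat.even_add_one])]

theorem bGen_eq : bGen = X * twoSq (hypSeries (3 / 4) (3 / 4) (3 / 2)) := by
  ext n
  rw [coeff_X_mul_twoSq, bGen, egf, coeff_mk, coeff_hypSeries_three, bSeq]
  split_ifs with h
  · simp
  · rw [Nat.two_mul_div_two_add_one_of_odd (Nat.not_even_iff_odd.mp h)]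
    push_cast
    ring

theorem uGen_eq : uGen = X * twoSq uRed := by
  ext n
  rw [coeff_X_mul_twoSq, uGen, egf, coeff_mk, uRed, coeff_mk, uSeq]
  split_ifs with h
  · simp
  · rw [Nat.two_mul_div_two_add_one_of_odd (Nat.not_even_iff_odd.mp h)]
    push_cast
    ring

theorem vGen_eq : vGen = twoSq (PowerSeries.mk fun n => v n / (2 ^ n * ((2 * n)! : ℚ))) := by
  ext n
  rw [coeff_twoSq, vGen, egf, coeff_mk, coeff_mk, vSeq]
  split_ifs with h
  · rw [Nat.two_mul_div_two_of_even h]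
    field_simp
  · simp

theorem vGen_sq : vGen ^ 2 = aGen := by
  rw [vGen_eq, ← map_pow, v_genFun, aGen_eq]

theorem uGen_mul_aGen : uGen * aGen = bGen := by
  have h0 : constantCoeff (hypSeries (1 / 4) (1 / 4) (1 / 2)) ≠ 0 := by
    rw [← coeff_zero_eq_constantCoeff_apply, coeff_hypSeries_one]
    simp [prodOne]
  rw [uGen_eq, aGen_eq, bGen_eq, mul_assoc, ← map_mul, uRed, u_genFun, mul_assoc,
    PowerSeries.inv_mul_cancel _ h0, mul_one]

/-! ### The hypergeometric differential equation and the Wronskian -/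

theorem prodOne_succ (n : ℕ) : prodOne (n + 1) = prodOne n * (4 * n + 1) ^ 2 := by
  rw [prodOne, prodOne, prod_Icc_succ_top (by omega)]
  push_cast
  ring

theorem prodThree_succ (n : ℕ) : prodThree (n + 1) = prodThree n * (4 * n + 3) ^ 2 := by
  rw [prodThree, prodThree, prod_Icc_succ_top (by omega)]
  push_cast
  ring

theorem aSeq_add_two (n : ℕ) : aSeq (n + 2) = 2 * (2 * n + 1) ^ 2 * aSeq n := by
  obtain ⟨m, rfl | rfl⟩ := n.even_or_odd'
  · rw [aSeq, aSeq, if_pos (by simp [Nat.even_add]), if_pos (by simp),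
      show (2 * m + 2) / 2 = m + 1 by omega, show 2 * m / 2 = m by omega, prodOne_succ]
    push_cast
    ring
  · rw [aSeq, aSeq, if_neg (by simp [parity_simps]), if_neg (by simp), mul_zero]

theorem bSeq_add_two (n : ℕ) : bSeq (n + 2) = 2 * (2 * n + 1) ^ 2 * bSeq n := by
  obtain ⟨m, rfl | rfl⟩ := n.even_or_odd'
  · rw [bSeq, bSeq, if_pos (by simp [Nat.even_add]), if_pos (by simp), mul_zero]
  · rw [bSeq, bSeq, if_neg (by simp [parity_simps]), if_neg (by simp),
      show (2 * m + 1 + 2) / 2 = m + 1 by omega, show (2 * m + 1) / 2 = m by omega,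
      prodThree_succ]
    push_cast
    ring

theorem coeff_X_mul_derivative (f : ℚ⟦X⟧) (n : ℕ) :
    coeff n (X * derivative ℚ f) = n * coeff n f := by
  rcases n with _ | n
  · simp
  · rw [coeff_succ_X_mul, coeff_derivative]
    push_cast
    ring

theorem egf_ode (a : ℕ → ℤ) (ha : ∀ n, a (n + 2) = 2 * (2 * n + 1) ^ 2 * a n) :
    (1 - 8 * X ^ 2) * derivative ℚ (derivative ℚ (egf fun n => a n)) =
      16 * X * derivative ℚ (egf fun n => a n) + 2 * egf fun n => a n := by
  set f := egf fun n => (a n : ℚ) with hf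
  -- With `θ = X · d/dX`, the factor `2 (2n + 1)² = 8n² + 8n + 2` of the recurrence becomes `8θ² +
  -- 8θ + 2`.
  have h1 : derivative ℚ (derivative ℚ f) =
      (8 : ℚ) • (X * derivative ℚ (X * derivative ℚ f)) + (8 : ℚ) • (X * derivative ℚ f) +
        (2 : ℚ) • f := by
    ext n
    simp only [map_add, map_smul, coeff_X_mul_derivative, coeff_derivative]
    rw [hf, egf, coeff_mk, coeff_mk, ha, Nat.factorial_succ, Nat.factorial_succ]
    have : (n ! : ℚ) ≠ 0 := by positivity
    push_cast
    simp only [smul_eq_mul]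
    field_simp
    ring
  rw [Derivation.leibniz, derivative_X] at h1
  simp only [smul_eq_mul, mul_one, PowerSeries.smul_eq_C_mul, map_ofNat] at h1
  linear_combination h1

/-- The factor `g` of the derivation `g · d/dX` sending `uGen` to `1`. -/
def gGen : ℚ⟦X⟧ := (1 - 8 * X ^ 2) * aGen ^ 2

theorem constantCoeff_aGen : constantCoeff aGen = 1 := by
  rw [← coeff_zero_eq_constantCoeff_apply]
  simp [aGen, egf, aSeq, prodOne]

theorem constantCoeff_gGen : constantCoeff gGen = 1 := by
  simp [gGen, constantCoeff_aGen]

/-- From `U = B / A` one gets `U' = (B' A - B A') / A²`. The common differential equation makes `(1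
- 8X²)(B' A - B A')` constant, with value 1 at 0. -/
theorem gGen_mul_derivative_uGen : gGen * derivative ℚ uGen = 1 := by
  have hA := egf_ode aSeq aSeq_add_two
  have hB := egf_ode bSeq bSeq_add_two
  change _ = 16 * X * derivative ℚ aGen + 2 * aGen at hA
  change _ = 16 * X * derivative ℚ bGen + 2 * bGen at hB
  change (1 - 8 * X ^ 2) * derivative ℚ (derivative ℚ aGen) = _ at hA
  change (1 - 8 * X ^ 2) * derivative ℚ (derivative ℚ bGen) = _ at hB
  have hW : (1 - 8 * X ^ 2) *
      (derivative ℚ bGen * aGen - bGen * derivative ℚ aGen) = 1 := by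
    apply derivative.ext
    · have h8 : derivative ℚ (1 - 8 * X ^ 2 : ℚ⟦X⟧) = -16 * X := by
        have : (8 : ℚ⟦X⟧) = C 8 := (map_ofNat C 8).symm
        rw [map_sub, derivative_one, Derivation.leibniz, this, derivative_C,
          PowerSeries.derivative_pow, derivative_X]
        simp only [smul_eq_mul, map_ofNat]
        push_cast
        ring
      rw [derivative_one, Derivation.leibniz, h8, map_sub, Derivation.leibniz,
        Derivation.leibniz]
      simp only [smul_eq_mul]
      linear_combination aGen * hB - bGen * hA
    · have hb : constantCoeff bGen = 0 := by
        rw [← coeff_zero_eq_constantCoeff_apply]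
        simp [bGen, egf, bSeq]
      have hb' : constantCoeff (derivative ℚ bGen) = 1 := by
        rw [← coeff_zero_eq_constantCoeff_apply, coeff_derivative]
        simp [bGen, egf, bSeq, prodThree]
      simp [hb, hb', constantCoeff_aGen]
  have h := congrArg (derivative ℚ) uGen_mul_aGen
  rw [Derivation.leibniz, smul_eq_mul, smul_eq_mul] at h
  rw [gGen]
  linear_combination hW + (1 - 8 * X ^ 2) * aGen * h -
    (1 - 8 * X ^ 2) * derivative ℚ aGen * uGen_mul_aGen

/-! ### Integrality -/

theorem v_isInt (n : ℕ) : ∃ a : ℤ, v n = a := by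
  induction n using Nat.strong_induction_on with
  | _ n ih =>
    rcases Nat.eq_zero_or_pos n with rfl | hn
    · exact ⟨1, by rw [v_zero]; simp⟩
    have ih' : ∀ m, ∃ a : ℤ, m < n → v m = a := fun m => by
      by_cases hm : m < n
      · exact (ih m hm).imp fun a ha _ => ha
      · exact ⟨0, fun h => absurd h hm⟩
    choose w hw using ih'
    have h2 : (2 : ℤ) ∣ ∑ m ∈ Ico 1 n, ((2 * n).choose (2 * m) : ℤ) * w m * w (n - m) := by
      rw [← Nat.cast_ofNat, ← ZMod.intCast_zmod_eq_zero_iff_dvd]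
      push_cast
      -- Modulo 2 the terms `m` and `n - m` cancel; at the fixed point `2m = n` the coefficient is a
      -- central binomial, which is even.
      refine sum_involution (fun m _ => n - m) ?_ ?_ ?_ ?_
      · intro m hm
        have hm := mem_Ico.mp hm
        rw [show n - (n - m) = m by omega, show 2 * (n - m) = 2 * n - 2 * m by omega,
          Nat.choose_symm (by omega)]
        have h : (2 : ZMod 2) = 0 := rfl
        linear_combination
          (((2 * n).choose (2 * m) : ZMod 2) * (w m : ZMod 2) * (w (n - m) : ZMod 2)) * h
      · intro m hm h0 h1
        have hm := mem_Ico.mp hm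
        apply h0
        have h : 2 ∣ (2 * n).choose (2 * m) := by
          rw [show 2 * m = n by omega]
          exact Nat.two_dvd_centralBinom_of_one_le hn
        rw [(ZMod.natCast_eq_zero_iff _ _).mpr h, zero_mul, zero_mul]
      · intro m hm
        have hm := mem_Ico.mp hm
        exact mem_Ico.mpr (by omega)
      · intro m hm
        have hm := mem_Ico.mp hm
        omega
    obtain ⟨c, hc⟩ := h2
    refine ⟨2 ^ (n - 1) * prodOne n - c, ?_⟩
    rw [v_rec n hn]
    have h3 : ∑ m ∈ Ico 1 n, ((2 * n).choose (2 * m) : ℚ) * v m * v (n - m) = 2 * c := by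
      have := congrArg (Int.cast : ℤ → ℚ) hc
      push_cast at this
      rw [← this]
      refine sum_congr rfl fun m hm => ?_
      have hm := mem_Ico.mp hm
      rw [hw m (by omega), hw (n - m) (by omega)]
    rw [h3]
    push_cast
    ring

theorem aGen_mem : aGen ∈ egfIdeal 1 := egf_mem aSeq fun _ => one_dvd _

theorem uGen_mem : uGen ∈ egfIdeal 1 := egf_mem uSeq fun _ => one_dvd _

theorem vGen_mem : vGen ∈ egfIdeal 1 := by
  intro n
  rw [vGen, factorial_mul_coeff_egf, vSeq]
  split_ifs
  · obtain ⟨a, ha⟩ := v_isInt (n / 2)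
    exact ⟨a, by simp [ha]⟩
  · exact ⟨0, by simp⟩

theorem one_sub_mem : (1 - 8 * X ^ 2 : ℚ⟦X⟧) ∈ egfIdeal 1 :=
  sub_mem one_mem_egfIdeal
    (by simpa using intCast_mul_mem 8 (pow_mem_egfIdeal X_mem_egfIdeal 2))

theorem gGen_mem : gGen ∈ egfIdeal 1 :=
  mul_mem_egfIdeal one_sub_mem (pow_mem_egfIdeal aGen_mem 2)

/-! ### `d n` as a Taylor coefficient of V with respect to U -/

theorem s_eq {n k : ℕ} (hk : k ≤ n) :
    2 ^ (n - k) * s n k = ((2 * n)! : ℚ) / ((2 * k)! : ℚ) * coeff (2 * n) (uGen ^ (2 * k)) := by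
  -- Formally `uGen` is `uSeries(√2 X) / √2`, so passing to `uGen ^ (2k)` multiplies the coefficient
  -- of degree `2n` by `2ⁿ / 2ᵏ`.
  have h1 : uSeries = X * expand 2 two_ne_zero uRed := by
    ext n
    rcases n with _ | n
    · simp [uSeries]
    · rw [coeff_succ_X_mul, uSeries, coeff_mk, coeff_expand]
      by_cases h : Even n
      · rw [if_pos h.add_one, if_pos h.two_dvd, uRed, coeff_mk, Nat.two_mul_div_two_of_even h,
          Nat.succ_div_of_not_dvd]
        rwa [← even_iff_two_dvd, Nat.even_add_one, not_not]
      · rw [if_neg (by rwa [Nat.not_odd_iff_even, Nat.even_add_one]),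
          if_neg (by rwa [← even_iff_two_dvd])]
  rw [s, h1, uGen_eq, mul_pow, mul_pow, ← map_pow, ← map_pow, coeff_X_pow_mul', coeff_X_pow_mul',
    if_pos (by omega), if_pos (by omega), coeff_twoSq, show 2 * n - 2 * k = 2 * (n - k) by omega,
    coeff_expand_mul, if_pos (by simp), Nat.mul_div_cancel_left _ two_pos]
  ring

theorem coeff_uGen_pow_of_lt {n k : ℕ} (h : n < k) : coeff n (uGen ^ k) = 0 := by
  rw [uGen_eq, mul_pow, coeff_X_pow_mul', if_neg (by omega)]

theorem coeff_uGen_pow_self (n : ℕ) : coeff n (uGen ^ n) = 1 := by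
  rw [uGen_eq, mul_pow, ← map_pow, coeff_X_pow_mul', if_pos le_rfl, Nat.sub_self, coeff_twoSq]
  have h0 : u 0 = 1 := by rw [u_rec]; simp [prodThree]
  simp [uRed, h0]

theorem coeff_uGen_pow_of_odd {n k : ℕ} (h : ¬Even n) : coeff n (uGen ^ (2 * k)) = 0 := by
  rw [uGen_eq, mul_pow, ← map_pow, coeff_X_pow_mul']
  split_ifs with hk
  · rw [coeff_twoSq, if_neg]
    rw [Nat.even_sub hk]
    simpa using h
  · rfl

/-- This is the recursion for `d` read as `V = ∑ d(k) U^(2k) / (2k)!`: the term `k = n` is `d n`,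
and the term `k = 0` contributes only when `n = 0`. -/
theorem v_eq_sum (n : ℕ) : v n = ∑ k ∈ range (n + 1),
    ((2 * n)! : ℚ) / ((2 * k)! : ℚ) * coeff (2 * n) (uGen ^ (2 * k)) * d k := by
  have hd := d_rec n
  have h1 : ∑ k ∈ Ico 1 n, 2 ^ (n - k) * s n k * d k = ∑ k ∈ Ico 1 n,
      ((2 * n)! : ℚ) / ((2 * k)! : ℚ) * coeff (2 * n) (uGen ^ (2 * k)) * d k :=
    sum_congr rfl fun k hk => by rw [s_eq (mem_Ico.mp hk).2.le]
  have hf : ((2 * n)! : ℚ) ≠ 0 := by positivity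
  rw [h1] at hd
  rw [sum_range_succ, coeff_uGen_pow_self, div_self hf]
  rcases Nat.eq_zero_or_pos n with rfl | hn
  · simp at hd ⊢
    exact hd.symm
  · rw [range_eq_Ico, sum_eq_sum_Ico_succ_bot hn, mul_zero, pow_zero, coeff_one,
      if_neg (by omega)]
    linarith

/-- The divided power `uGen ^ m / m!`. -/
def uDivPow (m : ℕ) : ℚ⟦X⟧ := (1 / m ! : ℚ) • uGen ^ m

theorem der_uDivPow_succ (m : ℕ) : der gGen (uDivPow (m + 1)) = uDivPow m := by
  have h : der gGen uGen = 1 := gGen_mul_derivative_uGen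
  rw [uDivPow, uDivPow, Derivation.map_smul, Derivation.leibniz_pow, h, Nat.add_sub_cancel, smul_eq_mul,
    mul_one, ← Nat.cast_smul_eq_nsmul ℚ, smul_smul, Nat.factorial_succ]
  congr 1
  have : (m ! : ℚ) ≠ 0 := by positivity
  push_cast
  field_simp

theorem constantCoeff_iterate_der_uDivPow (j m : ℕ) :
    constantCoeff ((der gGen)^[j] (uDivPow m)) = if m = j then 1 else 0 := by
  have hU : constantCoeff uGen = 0 := by rw [uGen_eq]; simp
  induction j generalizing m with
  | zero =>
    rcases m with _ | m
    · simp [uDivPow]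
    · simp [uDivPow, PowerSeries.smul_eq_C_mul, hU]
  | succ j ih =>
    rw [Function.iterate_succ_apply]
    rcases m with _ | m
    · have h1 : der gGen 1 = 0 := Derivation.map_one_eq_zero _
      rw [uDivPow, pow_zero, Derivation.map_smul, h1, smul_zero, iterate_map_zero (der gGen), map_zero,
        if_neg (by omega)]
    · rw [der_uDivPow_succ, ih]
      simp

/-- `d n` is the Taylor coefficient of `vGen` with respect to `uGen`. -/
theorem constantCoeff_iterate_der_vGen (n : ℕ) :
    constantCoeff ((der gGen)^[2 * n] vGen) = d n := by
  -- A finite partial sum suffices: it agrees with V through degree `2n`, so the remainder is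
  -- invisible to `δ^(2n)` at 0.
  set T : ℚ⟦X⟧ := ∑ k ∈ range (n + 1), d k • uDivPow (2 * k) with hT
  have hcoeff : ∀ m < 2 * n + 1, coeff m (vGen - T) = 0 := by
    intro m hm
    rw [map_sub, sub_eq_zero, vGen, egf, coeff_mk, vSeq, hT, map_sum]
    simp only [uDivPow, map_smul, smul_eq_mul]
    split_ifs with h
    · obtain ⟨l, rfl⟩ := h.two_dvd
      have hf : ((2 * l)! : ℚ) ≠ 0 := by positivity
      rw [Nat.mul_div_cancel_left _ two_pos, v_eq_sum, sum_div]
      have hsub : range (l + 1) ⊆ range (n + 1) := range_subset_range.mpr (by omega)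
      rw [← sum_subset hsub]
      · refine sum_congr rfl fun k _ => ?_
        field_simp
      · intro k _ hk
        rw [mem_range] at hk
        rw [coeff_uGen_pow_of_lt (by omega), mul_zero, mul_zero]
    · rw [zero_div, eq_comm]
      exact sum_eq_zero fun k _ => by rw [coeff_uGen_pow_of_odd h, mul_zero, mul_zero]
  have h1 : X ^ (2 * n) ∣ vGen - T := X_pow_dvd_iff.mpr fun m hm => hcoeff m (by omega)
  have h2 := constantCoeff_iterate_der constantCoeff_gGen h1
  rw [hcoeff _ (Nat.lt_succ_self _), mul_zero, iterate_der_sub, map_sub, sub_eq_zero] at h2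
  have h3 : (der gGen)^[2 * n] T =
      ∑ k ∈ range (n + 1), d k • (der gGen)^[2 * n] (uDivPow (2 * k)) := by
    have h4 (f : ℚ⟦X⟧) : (der gGen)^[2 * n] f =
        ((der gGen : ℚ⟦X⟧ →ₗ[ℚ] ℚ⟦X⟧) ^ (2 * n)) f := by
      rw [Module.End.pow_apply]; rfl
    simp only [h4, hT, map_sum, map_smul]
  rw [h2, h3, map_sum]
  simp [PowerSeries.smul_eq_C_mul, constantCoeff_iterate_der_uDivPow]

theorem d_isInt (n : ℕ) : ∃ a : ℤ, (a : ℚ) = d n := by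
  obtain ⟨a, ha⟩ := constantCoeff_of_mem (iterate_der_mem gGen_mem vGen_mem (2 * n))
  exact ⟨a, by rw [← constantCoeff_iterate_der_vGen, ha]; simp⟩

/-! ### Congruences for primes `p ≡ 1` modulo 4 -/

theorem dvd_aSeq {p : ℕ} (hp4 : p % 4 = 1) {n : ℕ} (hn : p ≤ n) (hp1 : 1 < p) :
    (p : ℤ) ∣ aSeq n := by
  rw [aSeq]
  split_ifs
  · refine Dvd.dvd.mul_left ?_ _
    -- This index gives the factor `4i - 3 = p`.
    have hi : (p + 3) / 4 ∈ Icc 1 (n / 2) := mem_Icc.mpr (by omega)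
    refine Dvd.dvd.trans ?_ (dvd_prod_of_mem _ hi)
    refine Dvd.dvd.trans ?_ (dvd_pow_self _ two_ne_zero)
    rw [show (4 * (((p + 3) / 4 : ℕ) : ℤ) - 3) = p by omega]
  · exact dvd_zero _

/-- For `2n + 1 = p`, every binomial in the recurrence for `u n` is an inner entry of row `p` of
Pascal's triangle. -/
theorem u_modEq_prodThree {p : ℕ} (hp : p.Prime) (hp2 : p % 2 = 1) :
    u ((p - 1) / 2) ≡ prodThree ((p - 1) / 2) [ZMOD p] := by
  rw [u_rec, Int.modEq_iff_dvd, sub_sub_cancel]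
  refine dvd_sum fun m hm => Dvd.dvd.mul_right (Dvd.dvd.mul_right ?_ _) _
  have hm := mem_range.mp hm
  rw [show 2 * ((p - 1) / 2) + 1 = p by omega]
  exact_mod_cast hp.dvd_choose_self (by omega) (by omega)

theorem frob_vGen_mem {p : ℕ} (hp : p.Prime) (hp4 : p % 4 = 1) :
    frob p (-uSeq p) gGen vGen ∈ egfIdeal p := by
  have hA : Chain p (-uSeq p) gGen aGen :=
    chain_egf hp gGen_mem aSeq fun n hn => dvd_aSeq hp4 hn hp.one_lt
  have hG : Chain p (-uSeq p) gGen gGen := by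
    have h1 : Chain p (-uSeq p) gGen (1 - 8 * X ^ 2) := by
      have := (chain_one (h := -uSeq p) (g := gGen) hp.ne_zero).sub
        ((chain_X.pow hp gGen_mem 2).intCast_mul 8)
      simpa using this
    exact h1.mul hp gGen_mem (hA.pow hp gGen_mem 2)
  have hX : frob p (-uSeq p) gGen X ∈ egfIdeal p :=
    frob_X_mem_prime hp hG constantCoeff_gGen uSeq gGen_mul_derivative_uGen (neg_neg _).symm
  refine frob_sqrt_mem hp (by rintro rfl; omega) gGen_mem hX vGen_mem
    -- This is the inverse of V: `V · W = V⁴ (1 - 8X²) U' = g U' = 1`, as `V⁴ = A²`.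
    (W := vGen ^ 3 * ((1 - 8 * X ^ 2) * derivative ℚ uGen)) ?_ ?_ (vGen_sq ▸ hA)
  · exact mul_mem_egfIdeal (pow_mem_egfIdeal vGen_mem 3)
      (mul_mem_egfIdeal one_sub_mem (derivative_mem_egfIdeal uGen_mem))
  · have h := gGen_mul_derivative_uGen
    rw [gGen, ← vGen_sq] at h
    linear_combination h

end Romik

end

theorem theorem1p2 :
    ∃ D : ℕ → ℤ, (∀ n : ℕ, (D n : ℚ) = Romik.d n) ∧
      ∀ p : ℕ, p.Prime → p % 4 = 1 → ∀ n : ℕ, (p + 1) / 2 ≤ n →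
        D (n + (p - 1) / 2) ≡
          -(2 ^ ((p - 1) / 2) * ∏ i ∈ Finset.Icc 1 ((p - 1) / 2), (4 * (i : ℤ) - 1) ^ 2) * D n
            [ZMOD (p : ℤ)] := by
  choose D hD using Romik.d_isInt
  refine ⟨D, hD, fun p hp hp4 n hn => ?_⟩
  change D (n + (p - 1) / 2) ≡ -(2 ^ ((p - 1) / 2) * Romik.prodThree ((p - 1) / 2)) * D n [ZMOD p]
  have hu : Romik.uSeq p = 2 ^ ((p - 1) / 2) * Romik.u ((p - 1) / 2) := by
    rw [Romik.uSeq, if_neg (by rw [Nat.even_iff]; omega), show p / 2 = (p - 1) / 2 by omega]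
  have hmod : Romik.uSeq p ≡ 2 ^ ((p - 1) / 2) * Romik.prodThree ((p - 1) / 2) [ZMOD p] :=
    hu ▸ (Romik.u_modEq_prodThree hp (by omega)).mul_left _
  refine Int.ModEq.trans ?_ (hmod.neg.mul_right _)
  -- With `n = q + 1`, apply `δ^(2q+1)` to `δᵖ V ≡ h δ V`: the orders become `2n + p - 1` and `2n`,
  -- both even as the Taylor coefficient formula requires.
  obtain ⟨q, rfl⟩ : ∃ q, n = q + 1 := ⟨n - 1, by omega⟩
  obtain ⟨a, ha⟩ := Romik.constantCoeff_of_mem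
    (Romik.iterate_der_mem Romik.gGen_mem (Romik.frob_vGen_mem hp hp4) (2 * q + 1))
  rw [Romik.frob, Romik.iterate_der_sub, Romik.iterate_der_intCast_mul, map_sub, map_mul,
    map_intCast, ← Function.iterate_add_apply, ← Function.iterate_succ_apply,
    show 2 * q + 1 + p = 2 * (q + 1 + (p - 1) / 2) by omega,
    show (2 * q + 1).succ = 2 * (q + 1) by omega, Romik.constantCoeff_iterate_der_vGen,
    Romik.constantCoeff_iterate_der_vGen, ← hD, ← hD] at ha
  refine (Int.modEq_iff_dvd.mpr ⟨a, ?_⟩).symm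
  exact_mod_cast ha
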